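/- Let $G$ be a countable group and let $K$ be an uncountable algebraically closed field. Let $X$ be an algebraic group over $K$ (a group object in the category of $K$-schemes whose underlying $K$-scheme is reduced and of finite type; not necessarily connected, affine or commutative), and let $A = X(K)$ be its set of $K$-points. Let $\tau \colon A^G \to A^G$ be an algebraic group cellular automaton, that is, there are a finite subset $M \subset G$ and a homomorphism of algebraic groups $f \colon X^M \to X$ over $K$, where $X^M$ is the fibered product over $K$ of copies of $X$ indexed by $M$, inducing $\mu \colon A^M \to A$ on $K$-points, such that $$\tau(c)(g) = \mu\big((g^{-1}c)\vert_M\big) \quad \text{for all } c \in A^G,\ g \in G,$$ where $(gc)(h) = c(g^{-1}h)$. Call two configurations in $A^G$ asymptotic if they agree outside a finite subset of $G$, and suppose that $\tau$ is post-surjective: for all $x, y \in A^G$ with $y$ asymptotic to $\tau(x)$ there exists $z \in A^G$ asymptotic to $x$ such that $\tau(z) = y$. Then there exists a finite subset $E \subset G$ with the following property: for all $x, y \in A^G$ such that $y\vert_{G \setminus \{1_G\}} = \tau(x)\vert_{G \setminus \{1_G\}}$, there exists $x' \in A^G$ such that $\tau(x') = y$ and $x'\vert_{G \setminus E} = x\vert_{G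 \setminus E}$. -/

import Mathlib

open CategoryTheory CategoryTheory.Limits CategoryTheory.MonoidalCategory AlgebraicGeometry

universe u v w

/-! ### Cellular automata over a group `G` with alphabet `A` -/

section CellularAutomata

variable {G : Type v} [Group G] {A : Type w}

/-- The Bernoulli shift on configurations: `(g c)(h) = c (g⁻¹ h)`. -/
def bernoulliShift (g : G) (c : G → A) : G → A := fun h => c (g⁻¹ * h)

/-- The map `τ` is the cellular automaton with memory set `M` and local defining map `μ`:
`τ(c)(g) = μ ((g⁻¹ c)|_M)` for all `c` and `g`. -/
def IsCellularAutomatonWith (τ : (G → A) → (G → A)) (M : Finset G) (μ : (M → A) → A) : Prop :=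
  ∀ (c : G → A) (g : G), τ c g = μ (fun m : M => bernoulliShift g⁻¹ c m)

/-- Two configurations are asymptotic if they agree outside some finite subset of `G`. -/
def Asymptotic (c d : G → A) : Prop :=
  ∃ E : Finset G, ∀ g, g ∉ E → c g = d g

/-- Post-surjectivity: if `y` is asymptotic to `τ(x)`, then `y = τ(z)` for some `z` asymptotic
to `x`. -/
def PostSurjective (τ : (G → A) → (G → A)) : Prop :=
  ∀ x y : G → A, Asymptotic y (τ x) → ∃ z : G → A, Asymptotic z x ∧ τ z = y

end CellularAutomata

/-! ### Algebraic groups and their rational points -/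

section AlgebraicGroups

variable {K : Type u} [Field K]

/-- An algebraic variety over `K`: a reduced `K`-scheme of finite type. -/
class IsAlgebraicVariety (X : Over (Spec (.of K))) : Prop where
  isReduced : IsReduced X.left
  locallyOfFiniteType : LocallyOfFiniteType X.hom
  quasiCompact : QuasiCompact X.hom

/-- The set `X(K)` of `K`-points of a `K`-group scheme `X`, that is, of morphisms of `K`-schemes
`Spec K ⟶ X` (the monoidal unit of `Over (Spec K)` is `Spec K` itself). -/
abbrev RationalPoints (X : Grp (Over (Spec (.of K)))) : Type u :=
  𝟙_ (Over (Spec (.of K))) ⟶ X.X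

/-- The fibered power `X^ι` over `K`, with its product structure of `K`-group scheme. -/
noncomputable abbrev groupPower (X : Grp (Over (Spec (.of K)))) (ι : Type v) [Finite ι] :
    Grp (Over (Spec (.of K))) :=
  ∏ᶜ fun _ : ι => X

/-- The underlying `K`-scheme of `X^ι` is the fibered product over `K` of copies of `X`. -/
noncomputable def groupPowerIso (X : Grp (Over (Spec (.of K)))) (ι : Type v) [Finite ι] :
    (groupPower X ι).X ≅ ∏ᶜ fun _ : ι => X.X :=
  PreservesProduct.iso (Grp.forget (Over (Spec (.of K)))) fun _ : ι => X

theorem groupPowerIso_hom_π (X : Grp (Over (Spec (.of K)))) {ι : Type v} [Finite ι] (i : ι) :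
    (groupPowerIso X ι).hom ≫ Pi.π (fun _ : ι => X.X) i =
      (Pi.π (fun _ : ι => X) i).hom.hom :=
  piComparison_comp_π (Grp.forget (Over (Spec (.of K)))) (fun _ : ι => X) i

/-- The identification of `X(K)^ι` with `X^ι(K)`: the point of `X^ι` with coordinates `a`. -/
noncomputable def pointOfCoords (X : Grp (Over (Spec (.of K)))) {ι : Type v} [Finite ι]
    (a : ι → RationalPoints X) : RationalPoints (groupPower X ι) :=
  Pi.lift a ≫ (groupPowerIso X ι).inv

/-- The coordinates of `pointOfCoords X a` are given by `a`. -/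
theorem pointOfCoords_π (X : Grp (Over (Spec (.of K)))) {ι : Type v} [Finite ι]
    (a : ι → RationalPoints X) (i : ι) :
    pointOfCoords X a ≫ (Pi.π (fun _ : ι => X) i).hom.hom = a i := by
  rw [pointOfCoords, Category.assoc, ← groupPowerIso_hom_π, Iso.inv_hom_id_assoc, Pi.lift_π]

/-- A point of `X^ι` is determined by its coordinates. -/
theorem eq_pointOfCoords (X : Grp (Over (Spec (.of K)))) {ι : Type v} [Finite ι]
    (p : RationalPoints (groupPower X ι)) :
    p = pointOfCoords X fun i => p ≫ (Pi.π (fun _ : ι => X) i).hom.hom := by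
  rw [pointOfCoords, Iso.eq_comp_inv]
  refine Pi.hom_ext _ _ fun i => ?_
  rw [Category.assoc, groupPowerIso_hom_π, Pi.lift_π]

/-- The map `X(K)^ι → X(K)` induced on `K`-points by a homomorphism of `K`-group schemes
`f : X^ι ⟶ X`. -/
noncomputable def inducedMap (X : Grp (Over (Spec (.of K)))) {ι : Type v} [Finite ι]
    (f : groupPower X ι ⟶ X) (a : ι → RationalPoints X) : RationalPoints X :=
  pointOfCoords X a ≫ f.hom.hom

/-- The set of algebraic group cellular automata over `(G, X, K)`: the cellular automata
`τ : X(K)^G → X(K)^G` admitting a finite memory set `M` whose local defining map is induced by a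
homomorphism of algebraic groups `X^M ⟶ X`. -/
def CAalgr (G : Type v) [Group G] (X : Grp (Over (Spec (.of K)))) :
    Set ((G → RationalPoints X) → (G → RationalPoints X)) :=
  {τ | ∃ (M : Finset G) (f : groupPower X M ⟶ X), IsCellularAutomatonWith τ M (inducedMap X f)}

end AlgebraicGroups

/-!
Being induced by a homomorphism of algebraic groups, `τ` is a group homomorphism, so it suffices to
lift, with supports in a common finite set `E`, the configurations with arbitrary value
`a ∈ X(K)` at `1` and trivial elsewhere. Post-surjectivity gives each of them a finitely supported
preimage. Let `H` be the countable subgroup generated by the memory set: replacing a preimage by `1`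
outside `H` keeps it a preimage, so only the countably many finite subsets `E ⊆ H` matter. For fixed
`E`, the liftable values `a` are the rational points of the image under a morphism `X^E ⟶ X` of a
closed subset, which is constructible by Chevalley's theorem. Over an uncountable algebraically
closed field, countably many constructible sets with a common point also share a rational point;
applied to complements, this shows that the images cover the whole scheme `X` and not just `X(K)`.
Since the constructible topology is compact, finitely many of the images suffice, and the union of
the corresponding sets `E` works for every `a`.
-/

section ConstructibleSets

open Topology Filter

variable {X : Type u} [TopologicalSpace X]

theorem eventually_mem_iff_of_isConstructible {s : Set X} (hs : IsConstructible s) (x : X) :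
    ∀ᶠ y in 𝓝 x, x ⤳ y → (y ∈ s ↔ x ∈ s) := by
  induction hs using IsConstructible.empty_union_induction with
  | open_retrocompact U hU _ =>
    by_cases hx : x ∈ U
    · filter_upwards [hU.mem_nhds hx] with y hy _ using iff_of_true hy hx
    · exact .of_forall fun y hxy => iff_of_false (fun hy => hx (hxy.mem_open hU hy)) hx
  | union s _ t _ hs ht =>
    filter_upwards [hs, ht] with y hys hyt hxy using or_congr (hys hxy) (hyt hxy)
  | compl s _ hs => filter_upwards [hs] with y hys hxy using not_congr (hys hxy)

theorem exists_mem_closedPoints_of_isConstructible [JacobsonSpace X] {s : Set X}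
    (hs : IsConstructible s) (hne : s.Nonempty) : ∃ x ∈ s, x ∈ closedPoints X := by
  obtain ⟨x, hx⟩ := hne
  obtain ⟨U, hUs, hU, hxU⟩ := eventually_nhds_iff.mp (eventually_mem_iff_of_isConstructible hs x)
  obtain ⟨y, ⟨hyU, hxy⟩, hy⟩ := nonempty_inter_closedPoints
    (Z := U ∩ closure {x}) ⟨x, hxU, subset_closure rfl⟩
    (hU.isLocallyClosed.inter (isClosed_closure (s := {x})).isLocallyClosed)
  exact ⟨y, (hUs y hyU (specializes_iff_mem_closure.mpr hxy)).mpr hx, hy⟩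

theorem isConstructible_of_isClosed [TopologicalSpace.NoetherianSpace X] {s : Set X}
    (hs : IsClosed s) : IsConstructible s :=
  isConstructible_compl.mp
    ((TopologicalSpace.NoetherianSpace.isCompact _).isConstructible hs.isOpen_compl)

theorem isOpen_constructibleTopology_of_isConstructible [CompactSpace X] {s : Set X}
    (hs : IsConstructible s) : IsOpen[constructibleTopology X] s := by
  suffices h : IsOpen[constructibleTopology X] s ∧ IsOpen[constructibleTopology X] sᶜ from h.1
  induction hs using IsConstructible.empty_union_induction with
  | open_retrocompact U hU hUc =>
    exact ⟨hUc.isCompact.isOpen_constructibleTopology_of_isOpen hU,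
      IsCompact.isOpen_constructibleTopology_of_isClosed (by rw [compl_compl]; exact hUc.isCompact)
        hU.isClosed_compl⟩
  | union s _ t _ hs ht =>
    rw [Set.compl_union]
    exact ⟨@IsOpen.union _ _ _ (constructibleTopology X) hs.1 ht.1,
      @IsOpen.inter _ (constructibleTopology X) _ _ hs.2 ht.2⟩
  | compl s _ hs => exact ⟨hs.2, by rw [compl_compl]; exact hs.1⟩

theorem exists_finset_iUnion_eq_univ_of_isConstructible [CompactSpace X] [QuasiSober X]
    [PrespectralSpace X] [QuasiSeparatedSpace X] {ι : Type w} {s : ι → Set X}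
    (hs : ∀ i, IsConstructible (s i)) (hcover : ⋃ i, s i = Set.univ) :
    ∃ t : Finset ι, ⋃ i ∈ t, s i = Set.univ := by
  obtain ⟨t, ht⟩ := isCompact_univ.elim_finite_subcover
    (fun i => (WithTopology.ofTopology ⁻¹' s i : Set (WithConstructibleTopology X)))
    (fun i => WithConstructibleTopology.isOpen_iff.mpr
      (isOpen_constructibleTopology_of_isConstructible (hs i)))
    (by rw [← Set.preimage_iUnion, hcover, Set.preimage_univ])
  refine ⟨t, Set.eq_univ_of_forall fun x => ?_⟩
  simpa using ht (Set.mem_univ (WithTopology.toTopology _ x))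

end ConstructibleSets

section CountableNullstellensatz

open Cardinal

variable {K : Type u} [Field K]

theorem isAlgebraic_of_rank_le_aleph0 [Uncountable K] {L : Type v} [Field L] [Algebra K L]
    (h : Module.rank K L ≤ ℵ₀) : Algebra.IsAlgebraic K L := by
  refine ⟨fun x => ?_⟩
  by_contra hx
  have hK : lift.{v} #K ≤ lift.{u} (Module.rank K L) :=
    (Transcendental.linearIndependent_sub_inv hx).cardinal_lift_le_rank
  refine not_countable (α := K) (mk_le_aleph0_iff.mp (lift_le_aleph0.mp (hK.trans ?_)))
  exact lift_le_aleph0.mpr h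

theorem rank_adjoin_le_aleph0 {R : Type v} [CommRing R] [Algebra K R] {s : Set R}
    (hs : s.Countable) : Module.rank K (Algebra.adjoin K s) ≤ ℵ₀ := by
  have := hs.to_subtype
  rw [Algebra.adjoin_eq_range]
  refine lift_le_aleph0.mp <|
    (lift_rank_range_le (MvPolynomial.aeval ((↑) : s → R)).toLinearMap).trans ?_
  rw [lift_le_aleph0, MvPolynomial.rank_eq_lift, lift_le_aleph0]
  exact mk_le_aleph0

variable [IsAlgClosed K] [Uncountable K]

theorem nonempty_algHom_of_rank_le_aleph0 {R : Type v} [CommRing R] [Algebra K R] [Nontrivial R]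
    (h : Module.rank K R ≤ ℵ₀) : Nonempty (R →ₐ[K] K) := by
  obtain ⟨m, hm⟩ := Ideal.exists_maximal R
  let := Ideal.Quotient.field m
  have : Module.rank K (R ⧸ m) ≤ ℵ₀ :=
    ((Ideal.Quotient.mkₐ K m).toLinearMap.rank_le_of_surjective
      (Ideal.Quotient.mkₐ_surjective K m)).trans h
  have : Algebra.IsAlgebraic K (R ⧸ m) := isAlgebraic_of_rank_le_aleph0 this
  exact ⟨(IsAlgClosed.lift (M := K)).comp (Ideal.Quotient.mkₐ K m)⟩

theorem exists_algHom_forall_ne_zero {R : Type v} [CommRing R] [IsDomain R] [Algebra K R]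
    {s : Set R} (hs : s.Countable) (hgen : Algebra.adjoin K s = ⊤) {ι : Type w} [Countable ι]
    {f : ι → R} (hf : ∀ i, f i ≠ 0) : ∃ φ : R →ₐ[K] K, ∀ i, φ (f i) ≠ 0 := by
  let L := FractionRing R
  let π : R →ₐ[K] L := IsScalarTower.toAlgHom K R L
  have hπf (i : ι) : π (f i) ≠ 0 :=
    (map_ne_zero_iff π (IsFractionRing.injective R L)).mpr (hf i)
  -- With the inverses of the `f i` adjoined, `R` still has countable dimension over `K`, hence a
  -- `K`-point, and this point lies on no hypersurface `f i = 0`.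
  let t : Set L := π '' s ∪ Set.range fun i => (π (f i))⁻¹
  have ht : t.Countable := (hs.image π).union (Set.countable_range _)
  have hπt (r : R) : π r ∈ Algebra.adjoin K t := by
    have hr : π r ∈ (Algebra.adjoin K s).map π := ⟨r, hgen ▸ Algebra.mem_top, rfl⟩
    rw [AlgHom.map_adjoin] at hr
    exact Algebra.adjoin_mono Set.subset_union_left hr
  obtain ⟨ψ⟩ := nonempty_algHom_of_rank_le_aleph0 (rank_adjoin_le_aleph0 (K := K) ht)
  refine ⟨ψ.comp (π.codRestrict _ hπt), fun i => IsUnit.ne_zero (IsUnit.map ψ ?_)⟩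
  exact IsUnit.of_mul_eq_one ⟨(π (f i))⁻¹, Algebra.subset_adjoin (Or.inr ⟨i, rfl⟩)⟩
    (Subtype.ext (mul_inv_cancel₀ (hπf i)))

theorem exists_algHom_specializes_comap {R : Type v} [CommRing R] [Algebra K R]
    [Algebra.FiniteType K R] (p : PrimeSpectrum R) {ι : Type w} [Countable ι]
    {U : ι → Set (PrimeSpectrum R)} (hU : ∀ i, IsOpen (U i)) (hp : ∀ i, p ∈ U i) :
    ∃ φ : R →ₐ[K] K, p ⤳ PrimeSpectrum.comap φ.toRingHom (IsLocalRing.closedPoint K) ∧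
      ∀ i, PrimeSpectrum.comap φ.toRingHom (IsLocalRing.closedPoint K) ∈ U i := by
  have hbasic (i : ι) : ∃ f : R, p ∈ PrimeSpectrum.basicOpen f ∧
      (PrimeSpectrum.basicOpen f : Set (PrimeSpectrum R)) ⊆ U i := by
    obtain ⟨_, ⟨f, rfl⟩, hpf, hfU⟩ :=
      PrimeSpectrum.isTopologicalBasis_basic_opens.exists_subset_of_mem_open (hp i) (hU i)
    exact ⟨f, hpf, hfU⟩
  choose f hpf hfU using hbasic
  obtain ⟨s, hs⟩ := Algebra.FiniteType.out (R := K) (A := R ⧸ p.asIdeal)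
  obtain ⟨φ, hφ⟩ := exists_algHom_forall_ne_zero s.countable_toSet hs
    fun i => mt Ideal.Quotient.eq_zero_iff_mem.mp (hpf i)
  let ψ := φ.comp (Ideal.Quotient.mkₐ K p.asIdeal)
  have hker (r : R) :
      r ∈ (PrimeSpectrum.comap ψ.toRingHom (IsLocalRing.closedPoint K)).asIdeal ↔ ψ r = 0 := by
    simp [IsLocalRing.closedPoint]
  refine ⟨ψ, (PrimeSpectrum.le_iff_specializes _ _).mp fun r hr => (hker r).mpr ?_,
    fun i => hfU i fun h => hφ i ((hker (f i)).mp h)⟩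
  exact (congr_arg φ (Ideal.Quotient.eq_zero_iff_mem.mpr hr)).trans (map_zero φ)

end CountableNullstellensatz

section UnderlyingPoints

open Topology

variable {K : Type u} [Field K] {X Y : Over (Spec (.of K))}

/-- The point of the underlying space of a `K`-scheme at which a rational point is located. -/
noncomputable def underlyingPoint (a : 𝟙_ (Over (Spec (.of K))) ⟶ X) : X.left :=
  a.left (IsLocalRing.closedPoint K)

theorem underlyingPoint_comp (a : 𝟙_ (Over (Spec (.of K))) ⟶ X) (f : X ⟶ Y) :
    underlyingPoint (a ≫ f) = f.left (underlyingPoint a) :=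
  rfl

theorem isNoetherian_left (X : Over (Spec (.of K))) [LocallyOfFiniteType X.hom]
    [QuasiCompact X.hom] : IsNoetherian X.left where
  toIsLocallyNoetherian := LocallyOfFiniteType.isLocallyNoetherian X.hom
  toCompactSpace := QuasiCompact.compactSpace_of_compactSpace X.hom

theorem locallyOfFiniteType_left [hX : LocallyOfFiniteType X.hom] (f : X ⟶ Y) :
    LocallyOfFiniteType f.left := by
  rw [← Over.w f] at hX
  exact locallyOfFiniteType_of_comp f.left Y.hom

section AlgClosed

variable [IsAlgClosed K] [LocallyOfFiniteType X.hom]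

theorem underlyingPoint_injective :
    Function.Injective (underlyingPoint : (𝟙_ (Over (Spec (.of K))) ⟶ X) → X.left) :=
  fun a b hab => Over.OverMorphism.ext
    (ext_of_apply_closedPoint_eq X.hom (Over.w a) (Over.w b) hab)

theorem range_underlyingPoint :
    Set.range (underlyingPoint : (𝟙_ (Over (Spec (.of K))) ⟶ X) → X.left) =
      closedPoints X.left := by
  refine Set.Subset.antisymm (Set.range_subset_iff.mpr fun a => ?_) fun x hx => ?_
  · exact (pointEquivClosedPoint X.hom ⟨a.left, Over.w a⟩).2
  · exact ⟨Over.homMk (pointOfClosedPoint X.hom x hx) (pointOfClosedPoint_comp X.hom x hx),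
      pointOfClosedPoint_apply X.hom x hx _⟩

theorem exists_underlyingPoint_mem_of_isConstructible {C : Set X.left} (hC : IsConstructible C)
    (hne : C.Nonempty) : ∃ a : 𝟙_ (Over (Spec (.of K))) ⟶ X, underlyingPoint a ∈ C := by
  have : JacobsonSpace X.left := LocallyOfFiniteType.jacobsonSpace X.hom
  obtain ⟨x, hxC, hx⟩ := exists_mem_closedPoints_of_isConstructible hC hne
  obtain ⟨a, rfl⟩ := range_underlyingPoint.ge hx
  exact ⟨a, hxC⟩

theorem underlyingPoint_mem_image_iff [QuasiCompact X.hom] [LocallyOfFiniteType Y.hom]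
    (f : X ⟶ Y) {C : Set X.left} (hC : IsConstructible C)
    (b : 𝟙_ (Over (Spec (.of K))) ⟶ Y) :
    underlyingPoint b ∈ f.left '' C ↔
      ∃ a : 𝟙_ (Over (Spec (.of K))) ⟶ X, underlyingPoint a ∈ C ∧ a ≫ f = b := by
  constructor
  · rintro ⟨x, hxC, hx⟩
    have := isNoetherian_left X
    have hb : IsClosed ({underlyingPoint b} : Set Y.left) := range_underlyingPoint.le ⟨b, rfl⟩
    obtain ⟨a, haC, hab⟩ := exists_underlyingPoint_mem_of_isConstructible
      (hC.inter (isConstructible_of_isClosed (hb.preimage f.left.continuous))) ⟨x, hxC, hx⟩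
    exact ⟨a, haC, underlyingPoint_injective hab⟩
  · rintro ⟨a, haC, rfl⟩
    exact ⟨_, haC, rfl⟩

end AlgClosed

section Uncountable

variable [IsAlgClosed K] [Uncountable K] [LocallyOfFiniteType X.hom]

theorem exists_specializes_underlyingPoint {ι : Type w} [Countable ι] {U : ι → Set X.left}
    (hU : ∀ i, IsOpen (U i)) {x : X.left} (hx : ∀ i, x ∈ U i) :
    ∃ a : 𝟙_ (Over (Spec (.of K))) ⟶ X,
      x ⤳ underlyingPoint a ∧ ∀ i, underlyingPoint a ∈ U i := by
  obtain ⟨V, hV, hxV, -⟩ := exists_isAffineOpen_mem_and_subset (TopologicalSpace.Opens.mem_top x)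
  obtain ⟨ρ, hρ⟩ : ∃ ρ, Spec.map ρ = hV.fromSpec ≫ X.hom := ⟨_, Spec.map_preimage _⟩
  let : Algebra K Γ(X.left, V) := ρ.hom.toAlgebra
  have : Algebra.FiniteType K Γ(X.left, V) := by
    change ρ.hom.FiniteType
    rw [← HasRingHomProperty.Spec_iff (P := @LocallyOfFiniteType), hρ]
    infer_instance
  have hp : hV.fromSpec (hV.primeIdealOf ⟨x, hxV⟩) = x := hV.fromSpec_primeIdealOf ⟨x, hxV⟩
  have hpU (i : ι) : hV.fromSpec (hV.primeIdealOf ⟨x, hxV⟩) ∈ U i := by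
    rw [hp]
    exact hx i
  obtain ⟨φ, hφ, hφU⟩ := exists_algHom_specializes_comap (K := K) (hV.primeIdealOf ⟨x, hxV⟩)
    (fun i => (hU i).preimage hV.fromSpec.continuous) hpU
  let a : Spec (.of K) ⟶ X.left := Spec.map (CommRingCat.ofHom φ.toRingHom) ≫ hV.fromSpec
  have ha : a ≫ X.hom = 𝟙 _ := by
    rw [Category.assoc, ← hρ, ← Spec.map_comp, ← Spec.map_id]
    congr 1
    ext y
    exact φ.commutes y
  have hxa : hV.fromSpec (hV.primeIdealOf ⟨x, hxV⟩) ⤳ a (IsLocalRing.closedPoint K) :=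
    hφ.map hV.fromSpec.continuous
  exact ⟨Over.homMk a ha, hp ▸ hxa, hφU⟩

theorem exists_underlyingPoint_forall_mem_of_isConstructible {ι : Type w} [Countable ι]
    {C : ι → Set X.left} (hC : ∀ i, IsConstructible (C i)) {x : X.left} (hx : ∀ i, x ∈ C i) :
    ∃ a : 𝟙_ (Over (Spec (.of K))) ⟶ X, ∀ i, underlyingPoint a ∈ C i := by
  choose U hUC hU hxU using fun i =>
    eventually_nhds_iff.mp (eventually_mem_iff_of_isConstructible (hC i) x)
  obtain ⟨a, hxa, haU⟩ := exists_specializes_underlyingPoint hU hxU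
  exact ⟨a, fun i => (hUC i _ (haU i) hxa).mpr (hx i)⟩

theorem exists_finset_forall_underlyingPoint_mem [QuasiCompact X.hom] {ι : Type w} [Countable ι]
    {C : ι → Set X.left} (hC : ∀ i, IsConstructible (C i))
    (hcover : ∀ a : 𝟙_ (Over (Spec (.of K))) ⟶ X, ∃ i, underlyingPoint a ∈ C i) :
    ∃ t : Finset ι, ∀ a : 𝟙_ (Over (Spec (.of K))) ⟶ X, ∃ i ∈ t, underlyingPoint a ∈ C i := by
  have := isNoetherian_left X
  have hC_cover : ⋃ i, C i = Set.univ := by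
    refine Set.eq_univ_of_forall fun x => ?_
    by_contra! hx
    obtain ⟨a, ha⟩ := exists_underlyingPoint_forall_mem_of_isConstructible
      (fun i => (hC i).compl) fun i hxi => hx (Set.mem_iUnion_of_mem i hxi)
    obtain ⟨i, hi⟩ := hcover a
    exact ha i hi
  obtain ⟨t, ht⟩ := exists_finset_iUnion_eq_univ_of_isConstructible hC hC_cover
  exact ⟨t, fun a => by simpa using ht.ge (Set.mem_univ (underlyingPoint a))⟩

theorem exists_finset_forall_exists_comp_eq [QuasiCompact X.hom] {ι : Type w} [Countable ι]
    {W : ι → Over (Spec (.of K))} [∀ i, LocallyOfFiniteType (W i).hom]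
    [∀ i, QuasiCompact (W i).hom] (f : ∀ i, W i ⟶ X) {C : ∀ i, Set (W i).left}
    (hC : ∀ i, IsConstructible (C i))
    (h : ∀ a : 𝟙_ (Over (Spec (.of K))) ⟶ X, ∃ i, ∃ p : 𝟙_ (Over (Spec (.of K))) ⟶ W i,
      underlyingPoint p ∈ C i ∧ p ≫ f i = a) :
    ∃ t : Finset ι, ∀ a : 𝟙_ (Over (Spec (.of K))) ⟶ X, ∃ i ∈ t,
      ∃ p : 𝟙_ (Over (Spec (.of K))) ⟶ W i, underlyingPoint p ∈ C i ∧ p ≫ f i = a := by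
  have hfC (i : ι) : IsConstructible ((f i).left '' C i) := by
    have := isNoetherian_left X
    have := isNoetherian_left (W i)
    have := locallyOfFiniteType_left (f i)
    exact (f i).left.isConstructible_image (hC i)
  simp only [← underlyingPoint_mem_image_iff (f _) (hC _)] at h ⊢
  exact exists_finset_forall_underlyingPoint_mem hfC h

end Uncountable

end UnderlyingPoints

section FiniteProducts

theorem isClosedUnderFiniteProducts_overObj {T : Type u} [Category.{v} T] [HasPullbacks T]
    (P : MorphismProperty T) [P.IsMultiplicative] [P.IsStableUnderBaseChange] (S : T)
    [HasFiniteProducts (Over S)] : (P.overObj (X := S)).IsClosedUnderFiniteProducts := by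
  let : CartesianMonoidalCategory (Over S) := Over.cartesianMonoidalCategory S
  have : (P.overObj (X := S)).IsClosedUnderBinaryProducts := by
    refine ⟨?_⟩
    rintro X ⟨p⟩
    refine P.overObj.prop_of_iso
      (p.isLimit.conePointsIsoOfNatIso
        (CartesianMonoidalCategory.tensorProductIsBinaryProduct (p.diag.obj ⟨.left⟩)
          (p.diag.obj ⟨.right⟩)) (diagramIsoPair p.diag)).symm ?_
    exact P.comp_mem _ _ (P.pullback_fst _ _ (p.prop_diag_obj _)) (p.prop_diag_obj _)
  exact .mk'

variable {S : Scheme.{u}} {ι : Type w} [Finite ι] (X : ι → Over S)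

instance locallyOfFiniteType_piObj_hom [hX : ∀ i, LocallyOfFiniteType (X i).hom] :
    LocallyOfFiniteType (∏ᶜ X).hom :=
  have := isClosedUnderFiniteProducts_overObj @LocallyOfFiniteType S
  ObjectProperty.prop_product (MorphismProperty.overObj @LocallyOfFiniteType) hX

instance quasiCompact_piObj_hom [hX : ∀ i, QuasiCompact (X i).hom] : QuasiCompact (∏ᶜ X).hom :=
  have := isClosedUnderFiniteProducts_overObj @QuasiCompact S
  ObjectProperty.prop_product (MorphismProperty.overObj @QuasiCompact) hX

end FiniteProducts

section GroupAlphabet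

namespace IsCellularAutomatonWith

variable {G : Type v} [Group G] {A : Type w} {τ : (G → A) → (G → A)} {M : Finset G}
  {μ : (M → A) → A}

theorem apply_congr (hτ : IsCellularAutomatonWith τ M μ) {c d : G → A} {g : G}
    (hcd : ∀ m ∈ M, c (g * m) = d (g * m)) : τ c g = τ d g := by
  rw [hτ, hτ]
  congr 1
  funext m
  simpa only [bernoulliShift, inv_inv] using hcd m m.2

theorem map_mulIndicator [One A] (hτ : IsCellularAutomatonWith τ M μ) (hτ1 : τ 1 = 1)
    {H : Subgroup G} (hMH : (M : Set G) ⊆ H) (c : G → A) :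
    τ ((H : Set G).mulIndicator c) = (H : Set G).mulIndicator (τ c) := by
  funext g
  have hmul {m : G} (hm : m ∈ M) : g * m ∈ H ↔ g ∈ H := H.mul_mem_cancel_right (hMH hm)
  by_cases hg : g ∈ (H : Set G)
  · rw [Set.mulIndicator_of_mem hg]
    exact hτ.apply_congr fun m hm => Set.mulIndicator_of_mem ((hmul hm).mpr hg) c
  · rw [Set.mulIndicator_of_notMem hg, ← Pi.one_apply (M := fun _ => A) g, ← hτ1]
    exact hτ.apply_congr fun m hm => Set.mulIndicator_of_notMem (mt (hmul hm).mp hg) c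

end IsCellularAutomatonWith

theorem countable_closure {G : Type v} [Group G] {s : Set G} (hs : s.Countable) :
    Countable (Subgroup.closure s) := by
  have := hs.to_subtype
  have : Countable (FreeGroup s) := (Quot.mk_surjective (r := FreeGroup.Red.Step)).countable
  rw [FreeGroup.closure_eq_range]
  exact Set.countable_range (FreeGroup.lift ((↑) : s → G))

theorem countable_setOf_finset_coe_subset {α : Type v} {s : Set α} (hs : s.Countable) :
    {t : Finset α | (t : Set α) ⊆ s}.Countable :=
  ((Set.countable_ofPred_finite_subset hs).preimage Finset.coe_injective).mono
    fun t ht => And.intro t.finite_toSet ht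

theorem extend_restrict_of_mulSupport_subset {α : Type v} {A : Type w} [One A] {s : Finset α}
    {z : α → A} (hz : Function.mulSupport z ⊆ s) :
    Function.extend ((↑) : s → α) (fun a => z a) 1 = z := by
  funext a
  by_cases ha : a ∈ s
  · exact Subtype.val_injective.extend_apply _ _ (⟨a, ha⟩ : s)
  · rw [Function.extend_apply' _ _ _ (by simpa using ha), Pi.one_apply,
      Function.notMem_mulSupport.mp (Set.notMem_subset hz ha)]

open scoped Classical in
/-- The elements `a` of the alphabet such that the configuration with value `a` at the neutral
element and trivial elsewhere has a preimage under `τ` which is trivial outside `E`. -/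
def liftableSingles {G : Type v} [One G] {A : Type w} [One A] (τ : (G → A) → (G → A))
    (E : Set G) : Set A :=
  {a | ∃ z : G → A, Function.mulSupport z ⊆ E ∧ τ z = Pi.mulSingle 1 a}

theorem liftableSingles_mono {G : Type v} [One G] {A : Type w} [One A] (τ : (G → A) → (G → A)) :
    Monotone (liftableSingles τ) :=
  fun _ _ hEF _ ⟨z, hz, hτz⟩ => ⟨z, hz.trans hEF, hτz⟩

theorem exists_map_eq_of_liftableSingles_eq_univ {G : Type v} [One G] {A : Type w} [Group A]
    {τ : (G → A) →* (G → A)} {E : Set G} (hE : liftableSingles τ E = Set.univ) {x y : G → A}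
    (hxy : ∀ g, g ≠ 1 → y g = τ x g) : ∃ x', τ x' = y ∧ ∀ g, g ∉ E → x' g = x g := by
  classical
  obtain ⟨z, hzE, hτz⟩ := hE.ge (Set.mem_univ ((τ x 1)⁻¹ * y 1))
  refine ⟨x * z, ?_, fun g hg => ?_⟩
  · funext g
    rw [map_mul, hτz, Pi.mul_apply]
    rcases eq_or_ne g 1 with rfl | hg
    · rw [Pi.mulSingle_eq_same, mul_inv_cancel_left]
    · rw [Pi.mulSingle_eq_of_ne hg, mul_one, hxy g hg]
  · rw [Pi.mul_apply, Function.notMem_mulSupport.mp (Set.notMem_subset hzE hg), mul_one]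

theorem PostSurjective.exists_mem_liftableSingles {G : Type v} [Group G] {A : Type w} [One A]
    {τ : (G → A) → (G → A)} (hpost : PostSurjective τ) (hτ1 : τ 1 = 1) {M : Finset G}
    {μ : (M → A) → A} (hτ : IsCellularAutomatonWith τ M μ) {H : Subgroup G}
    (hMH : (M : Set G) ⊆ H) (a : A) :
    ∃ E : Finset G, (E : Set G) ⊆ H ∧ a ∈ liftableSingles τ E := by
  classical
  have hasymp : Asymptotic (Pi.mulSingle 1 a) (τ 1) :=
    ⟨{1}, fun g hg => by
      rw [hτ1, Pi.mulSingle_eq_of_ne (Finset.notMem_singleton.mp hg), Pi.one_apply]⟩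
  obtain ⟨z, ⟨E, hE⟩, hz⟩ := hpost 1 _ hasymp
  have hzE : Function.mulSupport z ⊆ E := Function.mulSupport_subset_iff'.mpr hE
  refine ⟨{g ∈ E | g ∈ H}, fun g hg => (Finset.mem_filter.mp hg).2,
    (H : Set G).mulIndicator z, ?_, ?_⟩
  · rw [Set.mulSupport_mulIndicator]
    exact fun g hg => Finset.mem_coe.mpr (Finset.mem_filter.mpr ⟨hzE hg.2, hg.1⟩)
  · rw [hτ.map_mulIndicator hτ1 hMH, hz, Set.mulIndicator_eq_self]
    convert Pi.mulSupport_mulSingle_subset.trans (Set.singleton_subset_iff.mpr H.one_mem)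

end GroupAlphabet

section AlgebraicGroupAlphabet

open Topology
open scoped MonObj

variable {G : Type v} [Group G] {K : Type u} [Field K] {X : Grp (Over (Spec (.of K)))}

theorem pointOfCoords_mul {J : Type v} [Finite J] (a b : J → RationalPoints X) :
    pointOfCoords X (a * b) = pointOfCoords X a * pointOfCoords X b := by
  rw [eq_pointOfCoords X (pointOfCoords X a * pointOfCoords X b)]
  congr 1
  funext i
  rw [MonObj.mul_comp, pointOfCoords_π, pointOfCoords_π, Pi.mul_apply]

theorem inducedMap_mul {J : Type v} [Finite J] (f : groupPower X J ⟶ X)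
    (a b : J → RationalPoints X) :
    inducedMap X f (a * b) = inducedMap X f a * inducedMap X f b := by
  rw [inducedMap, pointOfCoords_mul, MonObj.mul_comp, inducedMap, inducedMap]

theorem CAalgr.exists_monoidHom_coe_eq {τ : (G → RationalPoints X) → (G → RationalPoints X)}
    (hτ : τ ∈ CAalgr G X) : ∃ φ : (G → RationalPoints X) →* (G → RationalPoints X), ⇑φ = τ := by
  obtain ⟨M, f, hf⟩ := hτ
  refine ⟨MonoidHom.mk' τ fun c d => funext fun g => ?_, rfl⟩
  rw [Pi.mul_apply, hf, hf, hf, ← inducedMap_mul]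
  rfl

/-- The value at `g` of the cellular automaton with local map `f : X^M ⟶ X` on configurations that
are trivial outside the finite set `E`, as a morphism `X^E ⟶ X` of `K`-schemes. -/
noncomputable def evalMorphism {M : Finset G} (f : groupPower X M ⟶ X) (E : Finset G) (g : G) :
    (∏ᶜ fun _ : E => X.X) ⟶ X.X :=
  Pi.lift (fun m : M => Function.extend ((↑) : E → G) (Pi.π fun _ : E => X.X) 1 (g * m)) ≫
    (groupPowerIso X M).inv ≫ f.hom.hom

variable {M : Finset G} {f : groupPower X M ⟶ X}
  {τ : (G → RationalPoints X) → (G → RationalPoints X)}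

theorem comp_evalMorphism (hf : IsCellularAutomatonWith τ M (inducedMap X f)) {E : Finset G}
    (p : 𝟙_ (Over (Spec (.of K))) ⟶ ∏ᶜ fun _ : E => X.X) (g : G) :
    p ≫ evalMorphism f E g =
      τ (Function.extend (↑) (fun e => p ≫ Pi.π (fun _ : E => X.X) e) 1) g := by
  have hone : (fun h => p ≫ (1 : G → ((∏ᶜ fun _ : E => X.X) ⟶ X.X)) h) = 1 :=
    funext fun _ => MonObj.comp_one p
  rw [hf, inducedMap, pointOfCoords, evalMorphism, ← Category.assoc, ← Category.assoc]
  congr 2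
  refine Pi.hom_ext _ _ fun m => ?_
  rw [Category.assoc, Pi.lift_π, Pi.lift_π, bernoulliShift, inv_inv,
    Function.apply_extend (p ≫ ·)]
  exact congr_fun (congr_arg (Function.extend _ _) hone) _

/-- The points of `X^E` at which all values off the neutral element of the cellular automaton with
local map `f` are trivial. -/
def singleLocus (f : groupPower X M ⟶ X) (E : Finset G) : Set (∏ᶜ fun _ : E => X.X).left :=
  {w | ∀ g, g ≠ 1 → (evalMorphism f E g).left w = underlyingPoint (1 : RationalPoints X)}

variable [IsAlgClosed K] [LocallyOfFiniteType X.X.hom]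

theorem isClosed_singleLocus (f : groupPower X M ⟶ X) (E : Finset G) :
    IsClosed (singleLocus f E) := by
  have h1 : IsClosed ({underlyingPoint (1 : RationalPoints X)} : Set X.X.left) :=
    range_underlyingPoint.le ⟨1, rfl⟩
  simp only [singleLocus, Set.ofPred_forall]
  exact isClosed_iInter fun g => isClosed_iInter fun _ =>
    h1.preimage (evalMorphism f E g).left.continuous

theorem underlyingPoint_mem_singleLocus_iff {E : Finset G}
    {p : 𝟙_ (Over (Spec (.of K))) ⟶ ∏ᶜ fun _ : E => X.X} :
    underlyingPoint p ∈ singleLocus f E ↔ ∀ g, g ≠ 1 → p ≫ evalMorphism f E g = 1 :=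
  forall₂_congr fun _ _ => by rw [← underlyingPoint_comp, underlyingPoint_injective.eq_iff]

theorem mem_liftableSingles_iff (hf : IsCellularAutomatonWith τ M (inducedMap X f))
    {E : Finset G} {a : RationalPoints X} :
    a ∈ liftableSingles τ E ↔ ∃ p : 𝟙_ (Over (Spec (.of K))) ⟶ ∏ᶜ fun _ : E => X.X,
      underlyingPoint p ∈ singleLocus f E ∧ p ≫ evalMorphism f E 1 = a := by
  classical
  simp only [underlyingPoint_mem_singleLocus_iff]
  constructor
  · rintro ⟨z, hz, hτz⟩
    let p := Pi.lift fun e : E => z e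
    have hp (g : G) : p ≫ evalMorphism f E g = τ z g := by
      simp only [comp_evalMorphism hf, p, Pi.lift_π, extend_restrict_of_mulSupport_subset hz]
    exact ⟨p, fun g hg => by rw [hp, hτz, Pi.mulSingle_eq_of_ne hg],
      by rw [hp, hτz, Pi.mulSingle_eq_same]⟩
  · rintro ⟨p, hp, rfl⟩
    refine ⟨Function.extend (↑) (fun e => p ≫ Pi.π (fun _ : E => X.X) e) 1, ?_, ?_⟩
    · exact Function.mulSupport_extend_one_subset.trans (by simp)
    · funext g
      rw [← comp_evalMorphism hf]
      rcases eq_or_ne g 1 with rfl | hg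
      · rw [Pi.mulSingle_eq_same]
      · rw [Pi.mulSingle_eq_of_ne hg, hp g hg]

variable [QuasiCompact X.X.hom] [Uncountable K]

theorem exists_finset_liftableSingles_eq_univ
    (hf : IsCellularAutomatonWith τ M (inducedMap X f)) {κ : Type w} [Countable κ]
    (E : κ → Finset G) (h : ∀ a, ∃ i, a ∈ liftableSingles τ (E i)) :
    ∃ F : Finset G, liftableSingles τ F = Set.univ := by
  classical
  have hC (i : κ) : IsConstructible (singleLocus f (E i)) :=
    have := isNoetherian_left (∏ᶜ fun _ : E i => X.X)
    isConstructible_of_isClosed (isClosed_singleLocus f (E i))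
  obtain ⟨t, ht⟩ := exists_finset_forall_exists_comp_eq (fun i => evalMorphism f (E i) 1) hC
    (by simpa only [mem_liftableSingles_iff hf] using h)
  refine ⟨t.biUnion E, Set.eq_univ_of_forall fun a => ?_⟩
  obtain ⟨i, hi, hai⟩ := ht a
  exact liftableSingles_mono τ (Finset.coe_subset.mpr (Finset.subset_biUnion_of_mem E hi))
    ((mem_liftableSingles_iff hf).mpr hai)

end AlgebraicGroupAlphabet

open scoped MonObj in
theorem mainTheorem6_general {G : Type v} [Group G] {K : Type u} [Field K] [IsAlgClosed K]
    [Uncountable K] (X : Grp (Over (Spec (.of K)))) [LocallyOfFiniteType X.X.hom]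
    [QuasiCompact X.X.hom] (τ : (G → RationalPoints X) → (G → RationalPoints X))
    (hτ : τ ∈ CAalgr G X) (hpost : PostSurjective τ) :
    ∃ E : Finset G, ∀ x y : G → RationalPoints X,
      (∀ g : G, g ≠ 1 → y g = τ x g) →
        ∃ x' : G → RationalPoints X, τ x' = y ∧ ∀ g : G, g ∉ E → x' g = x g := by
  obtain ⟨φ, rfl⟩ := CAalgr.exists_monoidHom_coe_eq hτ
  obtain ⟨M, f, hf⟩ := hτ
  have hM : (Subgroup.closure (M : Set G) : Set G).Countable := countable_closure M.countable_toSet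
  have := (countable_setOf_finset_coe_subset hM).to_subtype
  obtain ⟨E, hE⟩ := exists_finset_liftableSingles_eq_univ hf
    (fun F : {F : Finset G | (F : Set G) ⊆ Subgroup.closure (M : Set G)} => F) fun a => by
      obtain ⟨F, hFM, ha⟩ :=
        hpost.exists_mem_liftableSingles (map_one φ) hf Subgroup.subset_closure a
      exact ⟨⟨F, hFM⟩, ha⟩
  exact ⟨E, fun x y hxy => exists_map_eq_of_liftableSingles_eq_univ hE hxy⟩

theorem mainTheorem6 {G : Type v} [Group G] [Countable G]
    {K : Type u} [Field K] [IsAlgClosed K] [Uncountable K]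
    (X : Grp (Over (Spec (.of K)))) [IsAlgebraicVariety X.X]
    (τ : (G → RationalPoints X) → (G → RationalPoints X))
    (hτ : τ ∈ CAalgr G X) (hpost : PostSurjective τ) :
    ∃ E : Finset G, ∀ x y : G → RationalPoints X,
      (∀ g : G, g ≠ 1 → y g = τ x g) →
        ∃ x' : G → RationalPoints X, τ x' = y ∧ ∀ g : G, g ∉ E → x' g = x g :=
  have : LocallyOfFiniteType X.X.hom := IsAlgebraicVariety.locallyOfFiniteType
  have : QuasiCompact X.X.hom := IsAlgebraicVariety.quasiCompact
  mainTheorem6_general X τ hτ hpost
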